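/- Let $S^1=\mathbb R/2\pi\mathbb Z$, let $J=\left(\begin{smallmatrix}0&-1\\1&0\end{smallmatrix}\right)$, and let integers $k\ge 2$ and $n\ge 2$ be given. Let $K:S^1\to\mathbb R^2$, $\varphi\mapsto Y(\varphi)$, be a regular closed $C^k$ curve (self-intersections are allowed) with non-vanishing curvature, positively oriented in the sense that its total signed curvature (equivalently, its rotation index) is positive. Let $f:S^1\to S^1$ be a torsion map of class $C^k$ and order $n$, i.e. an orientation preserving $C^k$ diffeomorphism with $f^n=\mathrm{id}_{S^1}$ and $f^i\neq\mathrm{id}_{S^1}$ for $0<i<n$. Put $$D=\langle (Y\circ f-Y)',J(Y\circ f-Y)\rangle,\qquad s=-\frac{\langle Y',J(Y\circ f-Y)\rangle}{D},\qquad X=Y+s\,(Y\circ f-Y),$$ and let $C$ be the curve $\varphi\mapsto X(\varphi)$. We say that $C$ is well-defined if $D(\varphi)\ne0$ for all $\varphi\in S^1$. A line $\ell$ through distinct points $a,b$ is tangent to a closed $C^1$ curve $X$ at the parameter $\tau$ if $X(\tau)\in\ell$ and $\langle X'(\sigma),J(b-a)\rangle=o(\|X'(\sigma)\|)$ as $\sigma\to\tau$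 (the case $\sigma=\tau$ included). If $X'(\tau)\neq0$, this just says that $X'(\tau)$ is parallel to $\ell$; if $X'(\tau)=0$, it says that $\ell$ passes through $X(\tau)$ and is the limit of the tangent lines of $X$ at the regular parameters near $\tau$, if there are any. A Poncelet $n$-gon for $(K,C)$ is a closed polygon with vertices $Y(t_0),\dots,Y(t_{n-1})$, where $t_0,\dots,t_{n-1}\in S^1$ are pairwise distinct, such that consecutive vertices (cyclically) are different points and each line through two consecutive vertices is tangent to $C$ (so a side or its prolongation touches $C$). $(K,C)$ is a Poncelet pair (for $n$-gons) if for every $t_0\in S^1$ the point $Y(t_0)$ is a vertex, with parameter $t_0$, of a Poncelet $n$-gon. 1. Suppose that $C$ is well-defined. Then $C$ is of class $C^{k-1}$ and $(K,C)$ is a Poncelet pair for $n$-gons. More precisely, for every $\varphi\in S^1$ the points $Y(\varphi),Y(f(\varphi)),\dots,Y(f^{n-1}(\varphi))$ are the consecutive vertices of a Poncelet $n$-gon, and the line through $Y(\varphi)$ and $Y(f(\varphi))$ is tangent to $C$ at $X(\varphi)$. 2. Suppose that $C$ is well-defined and $k\ge3$. If the curvature of $C$ does not vanish, in the sense that $\langle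 X'',JX'\rangle\neq0$ everywhere on $S^1$, then $C$ is a regular curve, i.e. $X'\ne0$ everywhere; conversely, if $C$ is regular, then $\langle X'',JX'\rangle\neq0$ everywhere. 3. Suppose that $K$ has no self-intersections, i.e. $Y$ is injective on $S^1$. Then $C$ is well-defined and $0<s(\varphi)<1$ for all $\varphi\in S^1$. In particular the point of contact $X(\varphi)$ lies in the open segment between $Y(\varphi)$ and $Y(f(\varphi))$, so that the sides of the polygons themselves (not just their prolongations) touch $C$. -/

import Mathlib

open scoped Topology

namespace Poncelet

/-- The circle `S¹ = ℝ / 2πℤ`. -/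
abbrev S1 : Type := AddCircle (2 * Real.pi)

/-- The Euclidean plane. -/
abbrev Plane : Type := EuclideanSpace ℝ (Fin 2)

/-- Rotation by a quarter turn counterclockwise, `J = [[0, -1], [1, 0]]`. -/
noncomputable def J (v : Plane) : Plane := !₂[-(v 1), v 0]

/-- A closed curve `S¹ → ℝ²` is of class `C^k` if the corresponding `2π`-periodic map
`ℝ → ℝ²` is. -/
def IsCk (k : ℕ) (Y : S1 → Plane) : Prop := ContDiff ℝ k (fun x : ℝ => Y (x : S1))

/-- The derivative `Y'(φ)` of a closed curve with respect to the angular parameter. -/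
noncomputable def cderiv (Y : S1 → Plane) (φ : S1) : Plane :=
  deriv (fun x : ℝ => Y (φ + (x : S1))) 0

/-- A closed curve is regular if its velocity never vanishes. -/
def IsRegular (Y : S1 → Plane) : Prop := ∀ φ, cderiv Y φ ≠ 0

/-- `⟨Y'', J Y'⟩ = det (Y', Y'')`, the numerator of the signed curvature
`⟨Y'', J Y'⟩ / ‖Y'‖ ^ 3`. -/
noncomputable def curvatureNum (Y : S1 → Plane) (φ : S1) : ℝ :=
  inner ℝ (cderiv (cderiv Y) φ) (J (cderiv Y φ))

/-- Non-vanishing curvature, expressed as `⟨Y'', J Y'⟩ ≠ 0` so that it is meaningful for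
curves that are not known to be regular. -/
def HasNonvanishingCurvature (Y : S1 → Plane) : Prop := ∀ φ, curvatureNum Y φ ≠ 0

/-- The total signed curvature `∫ κ ds` of a closed regular curve (where `ds = ‖Y'‖ dφ`):
the total angle by which the tangent turns, i.e. `2π` times the rotation index. -/
noncomputable def totalCurvature (Y : S1 → Plane) : ℝ :=
  ∫ x in (0 : ℝ)..(2 * Real.pi), curvatureNum Y (x : S1) / ‖cderiv Y (x : S1)‖ ^ 2

/-- A closed regular curve, possibly with self-intersections, is positively oriented if its
tangent turns counterclockwise in total, i.e. if its rotation index is positive. -/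
def IsPositivelyOriented (Y : S1 → Plane) : Prop := 0 < totalCurvature Y

/-- `f` is an orientation preserving `C^k` diffeomorphism of `S¹` (for `k ≥ 1`): it is bijective
and has a `C^k` lift `F : ℝ → ℝ` with positive derivative. -/
def IsOrientationPreservingDiffeo (k : ℕ) (f : S1 → S1) : Prop :=
  Function.Bijective f ∧
    ∃ F : ℝ → ℝ, ContDiff ℝ k F ∧ (∀ x, 0 < deriv F x) ∧ ∀ x : ℝ, ((F x : ℝ) : S1) = f (x : S1)

/-- `f` is a torsion map of class `C^k` and of order `n`. -/
structure IsTorsionMap (k n : ℕ) (f : S1 → S1) : Prop where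
  diffeo : IsOrientationPreservingDiffeo k f
  iterate_eq : f^[n] = id
  iterate_ne : ∀ i, 0 < i → i < n → f^[i] ≠ id

/-- The denominator `⟨(Y ∘ f - Y)', J (Y ∘ f - Y)⟩` in the formula for the envelope. -/
noncomputable def envelopeDenom (Y : S1 → Plane) (f : S1 → S1) (φ : S1) : ℝ :=
  inner ℝ (cderiv (fun ψ => Y (f ψ) - Y ψ) φ) (J (Y (f φ) - Y φ))

/-- The contact parameter `s = - ⟨Y', J (Y ∘ f - Y)⟩ / ⟨(Y ∘ f - Y)', J (Y ∘ f - Y)⟩`. -/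
noncomputable def contactParam (Y : S1 → Plane) (f : S1 → S1) (φ : S1) : ℝ :=
  -(inner ℝ (cderiv Y φ) (J (Y (f φ) - Y φ)) / envelopeDenom Y f φ)

/-- `s` and the envelope are well-defined: the denominator has no zeros. -/
def EnvelopeWellDefined (Y : S1 → Plane) (f : S1 → S1) : Prop :=
  ∀ φ, envelopeDenom Y f φ ≠ 0

/-- The envelope
`X = Y - (⟨Y', J (Y ∘ f - Y)⟩ / ⟨(Y ∘ f - Y)', J (Y ∘ f - Y)⟩) (Y ∘ f - Y)`. -/
noncomputable def envelope (Y : S1 → Plane) (f : S1 → S1) (φ : S1) : Plane :=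
  Y φ - (inner ℝ (cderiv Y φ) (J (Y (f φ) - Y φ)) / envelopeDenom Y f φ) • (Y (f φ) - Y φ)

/-- The line through the distinct points `a`, `b` is tangent to the `C^1` curve `X` at the
parameter `τ`: it passes through `X τ`, and the tangent direction of `X` tends to the direction
of the line at `τ`. If `X' τ ≠ 0` this says exactly that `X' τ` is parallel to `b - a`; if
`X' τ = 0`, the line has to be the limit of the tangent lines of `X` at the regular parameters
near `τ` (and nothing more is required if there are none). -/
def IsTangentAt (X : S1 → Plane) (τ : S1) (a b : Plane) : Prop :=
  X τ ∈ affineSpan ℝ {a, b} ∧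
    (fun σ => (inner ℝ (cderiv X σ) (J (b - a)) : ℝ)) =o[𝓝 τ] (fun σ => cderiv X σ)

/-- A Poncelet `n`-gon with vertices `Y (t 0), …, Y (t (n - 1))`: a closed polygon inscribed in
`Y`, with pairwise distinct parameters of its vertices and non-degenerate sides, each of which
has, possibly after prolongation, a point of tangency with `X`. The points of the plane at
distinct parameters may coincide only where `Y` intersects itself. -/
structure IsPonceletPolygon (n : ℕ) (Y X : S1 → Plane) (t : ℕ → S1) : Prop where
  closed : t n = t 0
  injOn : Set.InjOn t (Set.Iio n)
  side_ne : ∀ i < n, Y (t i) ≠ Y (t (i + 1))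
  tangent : ∀ i < n, ∃ τ, IsTangentAt X τ (Y (t i)) (Y (t (i + 1)))

/-- The closed curves `Y` (vertex curve) and `X` (envelope, of class `C^1`) form a Poncelet pair
for `n`-gons. -/
structure IsPonceletPair (n : ℕ) (Y X : S1 → Plane) : Prop where
  two_le : 2 ≤ n
  continuous_vertexCurve : Continuous Y
  envelope_C1 : IsCk 1 X
  exists_polygon : ∀ q : S1, ∃ t : ℕ → S1, t 0 = q ∧ IsPonceletPolygon n Y X t

end Poncelet

/-!
# The envelope of a torsion map and Poncelet polygons

Write `y` for the `2π`-periodic lift of `Y`, `v = y ∘ F - y` for the chords, where `F` is a lift of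
`f`, and `det (a, b) = ⟨b, J a⟩`. The envelope is `X = y - q v` with `q = det (v, y') / det (v, v')`.
This choice of `q` gives `det (v, X') = 0`, so `X' = μ v` for a function `μ`
(`exists_deriv_lineEnvelope_eq_smul`). Three facts follow. The line through `Y φ` and `Y (f φ)` is
tangent to `X` at `φ`, also where `X' = 0` (`isTangentAt_of_cderiv_eq_smul`). The orbit of a point
under `f` closes up to a Poncelet polygon after `n` steps; its vertices have different parameters
because a map of finite order with a fixed point is the identity (`eq_id_of_fixedPoint`). Finally,
`det (X', X'') = μ² det (v, v')` (`cross_deriv_deriv_lineEnvelope`), so that the curvature of the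
envelope vanishes exactly where its velocity does.

If `Y` is injective, everything rests on the strict convexity of `Y`: for `φ ≠ ψ` the point `Y ψ`
lies strictly to the left of the tangent at `Y φ` (`cross_cderiv_chord_pos`). Applied to the two
ends of a chord this shows that `s = A / (A + F' B)` with `A, B > 0`. Convexity is a consequence of
Hopf's Umlaufsatz (`exists_tangentAngle`): the tangent angle, strictly increasing by the sign of
the curvature, grows by exactly `2π` in one period, so the height of the curve over a tangent first
increases, then decreases, and it is `0` at both ends. The Umlaufsatz is proved with the continuous
logarithm of the map `(a, h) ↦ (y (a + h) - y a) / (2 sin (h / 2))`, which extends to a continuous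
map without zeros on the whole of `ℝ × ℝ`.
-/

namespace Poncelet

/-! ### The secant map of a closed curve -/

section

open Complex Set

/-- The secant direction of a `2π`-periodic plane curve `z` from parameter `a` to parameter
`a + h`, at `p = (a, h)`: the chord divided by `2 sin (h / 2)`. Where the denominator vanishes,
that is for `h ∈ 2πℤ`, the value is the limit of these quotients, `z' a` up to sign. With this
normalization the map is defined and continuous on the whole plane and has no zeros if `z` is
regular and simple. -/
noncomputable def secant (z : ℝ → ℂ) (p : ℝ × ℝ) : ℂ :=
  if Real.sin (p.2 / 2) = 0 then (Real.cos (p.2 / 2) : ℂ) * deriv z p.1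
  else (z (p.1 + p.2) - z p.1) / ((2 * Real.sin (p.2 / 2) : ℝ) : ℂ)

lemma secant_zero (z : ℝ → ℂ) (a : ℝ) : secant z (a, 0) = deriv z a := by
  simp [secant]

lemma sin_half_ne_zero {h : ℝ} (h0 : h ≠ 0) (hlt : |h| < 2 * Real.pi) :
    Real.sin (h / 2) ≠ 0 := by
  rw [abs_lt] at hlt
  rw [Ne, Real.sin_eq_zero_iff_of_lt_of_lt (by linarith [hlt.1]) (by linarith [hlt.2])]
  simpa using h0

lemma sinc_half_ne_zero {h : ℝ} (hlt : |h| < 2 * Real.pi) : Real.sinc (h / 2) ≠ 0 := by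
  by_cases h0 : h = 0
  · simp [h0]
  · rw [Real.sinc_of_ne_zero (by simpa using h0)]
    exact div_ne_zero (sin_half_ne_zero h0 hlt) (by simpa using h0)

/-- Near the diagonal the secant direction is a mean of the velocity divided by a value of `sinc`,
which shows that the singularity at `h = 0` is removable. -/
lemma secant_eq_integral {z : ℝ → ℂ} (hz : ContDiff ℝ 1 z) (a : ℝ) {h : ℝ}
    (hlt : |h| < 2 * Real.pi) :
    secant z (a, h) = (∫ t in (0 : ℝ)..1, deriv z (a + t * h)) / (Real.sinc (h / 2) : ℂ) := by
  by_cases h0 : h = 0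
  · simp [h0, secant]
  · have hs := sin_half_ne_zero h0 hlt
    have key : h • ∫ t in (0 : ℝ)..1, deriv z (a + t • h) = z (a + h) - z a := by
      apply intervalIntegral.integral_unitInterval_deriv_eq_sub
      · have := hz.continuous_deriv le_rfl
        exact Continuous.continuousOn (by fun_prop)
      · intro t _
        exact (hz.differentiable (by norm_num) _).hasDerivAt
    simp only [smul_eq_mul, real_smul] at key
    have hc : (h : ℂ) ≠ 0 := by exact_mod_cast h0
    have hs' : (Real.sin (h / 2) : ℂ) ≠ 0 := by exact_mod_cast hs
    simp only [secant, hs, if_false, ← key]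
    rw [Real.sinc_of_ne_zero (by simpa using h0)]
    push_cast at hs' ⊢
    field_simp
    simp only [mul_comm]

lemma secant_add_period {z : ℝ → ℂ} (hper : Function.Periodic z (2 * Real.pi)) (a h : ℝ) :
    secant z (a, h + 2 * Real.pi) = - secant z (a, h) := by
  have e : (h + 2 * Real.pi) / 2 = h / 2 + Real.pi := by ring
  simp only [secant, e, Real.sin_add_pi, Real.cos_add_pi, neg_eq_zero, ← add_assoc, hper (a + h)]
  split_ifs
  · push_cast; ring
  · rw [mul_neg, Complex.ofReal_neg, div_neg]

lemma periodic_deriv {E : Type*} [NormedAddCommGroup E] [NormedSpace ℝ E] {z : ℝ → E} {c : ℝ}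
    (hper : Function.Periodic z c) : Function.Periodic (deriv z) c := by
  intro a
  rw [← deriv_comp_add_const]
  congr 1
  exact funext hper

/-- Traversing a secant backwards gives the same direction: both the chord and the sine change
sign. -/
lemma secant_swap {z : ℝ → ℂ} (hper : Function.Periodic z (2 * Real.pi)) (a h : ℝ) :
    secant z (a + h, -h) = secant z (a, h) := by
  simp only [secant, neg_div, Real.sin_neg, Real.cos_neg, neg_eq_zero, add_neg_cancel_right]
  split_ifs with hs
  · obtain ⟨k, hk⟩ := Real.sin_eq_zero_iff.1 hs
    have : h = k * (2 * Real.pi) := by linarith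
    rw [this, ((periodic_deriv hper).int_mul k) a]
  · rw [mul_neg, Complex.ofReal_neg, div_neg, ← neg_div, neg_sub]

lemma continuous_secant {z : ℝ → ℂ} (hz : ContDiff ℝ 1 z)
    (hper : Function.Periodic z (2 * Real.pi)) : Continuous (secant z) := by
  have hpi := Real.pi_pos
  have hint : Continuous fun p : ℝ × ℝ => ∫ t in (0 : ℝ)..1, deriv z (p.1 + t * p.2) := by
    apply intervalIntegral.continuous_parametric_intervalIntegral_of_continuous'
    have := hz.continuous_deriv le_rfl
    simp only [Function.uncurry_def]
    fun_prop
  have near : ∀ p : ℝ × ℝ, |p.2| < 2 * Real.pi → ContinuousAt (secant z) p := by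
    intro p hp
    have hopen : {q : ℝ × ℝ | |q.2| < 2 * Real.pi} ∈ 𝓝 p :=
      (isOpen_lt (by fun_prop) continuous_const).mem_nhds hp
    have hc : ContinuousAt (fun q : ℝ × ℝ =>
        (∫ t in (0 : ℝ)..1, deriv z (q.1 + t * q.2)) / (Real.sinc (q.2 / 2) : ℂ)) p := by
      refine hint.continuousAt.div ?_ (by exact_mod_cast sinc_half_ne_zero hp)
      have := Real.continuous_sinc
      exact Continuous.continuousAt (by fun_prop)
    refine hc.congr ?_
    filter_upwards [hopen] with q hq
    exact (secant_eq_integral hz q.1 hq).symm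
  -- Up to sign, `secant z` is periodic in the second variable.
  have shift : ∀ n : ℤ, ∀ p : ℝ × ℝ,
      secant z p = (-1) ^ n * secant z (p.1, p.2 - n * (2 * Real.pi)) := by
    intro n p
    have step : ∀ h : ℝ, secant z (p.1, h - 2 * Real.pi) = - secant z (p.1, h) := by
      intro h
      have := secant_add_period hper p.1 (h - 2 * Real.pi)
      rw [sub_add_cancel] at this
      rw [this, neg_neg]
    induction n using Int.induction_on with
    | zero => simp
    | succ n ih =>
      rw [ih, show p.2 - ((n + 1 : ℤ) : ℝ) * (2 * Real.pi)
        = p.2 - (n : ℤ) * (2 * Real.pi) - 2 * Real.pi by push_cast; ring, step,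
        zpow_add_one₀ (by norm_num)]
      ring
    | pred n ih =>
      rw [ih, show p.2 - ((-(n : ℤ) : ℤ) : ℝ) * (2 * Real.pi)
        = p.2 - ((-(n : ℤ) - 1 : ℤ) : ℝ) * (2 * Real.pi) - 2 * Real.pi by push_cast; ring, step,
        zpow_sub_one₀ (by norm_num)]
      norm_num
  rw [continuous_iff_continuousAt]
  intro p
  have hr : |p.2 - round (p.2 / (2 * Real.pi)) * (2 * Real.pi)| < 2 * Real.pi := by
    have h1 := abs_sub_round (p.2 / (2 * Real.pi))
    have h2 : p.2 - round (p.2 / (2 * Real.pi)) * (2 * Real.pi)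
        = (p.2 / (2 * Real.pi) - round (p.2 / (2 * Real.pi))) * (2 * Real.pi) := by
      field_simp
    rw [h2, abs_mul, abs_of_pos (by positivity : 0 < 2 * Real.pi)]
    nlinarith
  rw [show secant z = _ from funext (shift (round (p.2 / (2 * Real.pi))))]
  refine continuousAt_const.mul (ContinuousAt.comp (g := secant z) ?_ ?_)
  · exact near _ hr
  · exact Continuous.continuousAt (by fun_prop)

lemma secant_ne_zero {z : ℝ → ℂ} (hreg : ∀ a, deriv z a ≠ 0)
    (hinj : ∀ a h, Real.sin (h / 2) ≠ 0 → z (a + h) ≠ z a) (p : ℝ × ℝ) : secant z p ≠ 0 := by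
  unfold secant
  split_ifs with hs
  · refine mul_ne_zero ?_ (hreg _)
    intro hc
    have hc' : Real.cos (p.2 / 2) = 0 := by exact_mod_cast hc
    have := Real.sin_sq_add_cos_sq (p.2 / 2)
    simp [hs, hc'] at this
  · refine div_ne_zero (sub_ne_zero.2 (hinj _ _ hs)) ?_
    exact_mod_cast mul_ne_zero two_ne_zero hs

/-! ### The rotation index of a simple closed curve -/

lemma exists_continuous_log {A : Type*} [TopologicalSpace A] [SimplyConnectedSpace A]
    [LocallyPathConnectedSpace A] {g : A → ℂ} (hg : Continuous g) (h0 : ∀ a, g a ≠ 0) :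
    ∃ L : A → ℂ, Continuous L ∧ ∀ a, exp (L a) = g a := by
  obtain ⟨a₀⟩ := (inferInstance : Nonempty A)
  obtain ⟨F, ⟨-, hF⟩, -⟩ := isCoveringMapOn_exp.existsUnique_continuousMap_lifts
    ⟨g, hg⟩ (a₀ := a₀) (e₀ := Complex.log (g a₀)) (exp_log (h0 a₀)) (fun a => h0 a)
  exact ⟨F, F.continuous, fun a => congrFun hF a⟩

lemma eq_of_exp_eq {A : Type*} [TopologicalSpace A] [PreconnectedSpace A] {g : A → ℂ}
    (hg : Continuous g) (h : ∀ a b, exp (g a) = exp (g b)) (a b : A) : g a = g b :=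
  isCoveringMap_exp.const_of_comp hg (fun a b => Subtype.ext (h a b)) a b

/-- An angle that starts at `0`, ends at an odd multiple of `π` and keeps a nonnegative sine
ends at `π`. -/
lemma eq_zero_of_sin_nonneg {ψ : ℝ → ℝ} {T : ℝ} (hT : 0 ≤ T) (hψ : Continuous ψ) (h0 : ψ 0 = 0)
    {p : ℤ} (hp : ψ T = (2 * p + 1) * Real.pi) (hs : ∀ t ∈ Icc 0 T, 0 ≤ Real.sin (ψ t)) :
    p = 0 := by
  have hpi := Real.pi_pos
  rcases lt_trichotomy p 0 with h | h | h
  · exfalso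
    have h' : (p : ℝ) ≤ -1 := by exact_mod_cast (by omega : p ≤ -1)
    obtain ⟨t, ht, e⟩ := intermediate_value_Icc' hT hψ.continuousOn
      (show -(Real.pi / 2) ∈ Icc (ψ T) (ψ 0) by
        rw [h0, hp]; constructor <;> nlinarith)
    have := hs t ht
    rw [e, Real.sin_neg, Real.sin_pi_div_two] at this
    linarith
  · exact h
  · exfalso
    have h' : (1 : ℝ) ≤ p := by exact_mod_cast (by omega : 1 ≤ p)
    obtain ⟨t, ht, e⟩ := intermediate_value_Icc hT hψ.continuousOn
      (show Real.pi / 2 + Real.pi ∈ Icc (ψ 0) (ψ T) by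
        rw [h0, hp]; constructor <;> nlinarith)
    have := hs t ht
    rw [e, Real.sin_add_pi, Real.sin_pi_div_two] at this
    linarith

/-- A closed curve has a lowest point, and its tangent there is horizontal. -/
lemma exists_support {z : ℝ → ℂ} (hz : ContDiff ℝ 1 z)
    (hper : Function.Periodic z (2 * Real.pi)) :
    ∃ a, (deriv z a).im = 0 ∧ ∀ b, (z a).im ≤ (z b).im := by
  have hc : Continuous fun x => (z x).im := by have := hz.continuous; fun_prop
  obtain ⟨a, -, ha⟩ := isCompact_Icc.exists_isMinOn (s := Icc 0 (0 + 2 * Real.pi))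
    ⟨0, by constructor <;> linarith [Real.pi_pos]⟩ hc.continuousOn
  have hmin : ∀ b, (z a).im ≤ (z b).im := by
    intro b
    obtain ⟨c, hc, e⟩ := hper.exists_mem_Ico₀ (by linarith [Real.pi_pos]) b
    rw [e]
    exact ha ⟨hc.1, by linarith [hc.2]⟩
  refine ⟨a, ?_, hmin⟩
  have hd : HasDerivAt (fun x => (z x).im) (deriv z a).im a := by
    have := (hz.differentiable (by norm_num) a).hasDerivAt
    exact imCLM.hasFDerivAt.comp_hasDerivAt a this
  exact IsLocalMin.hasDerivAt_eq_zero (Filter.Eventually.of_forall hmin) hd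

/-- Hopf's Umlaufsatz: the tangent of a simple closed regular curve turns by `±2π`. Let `L` be a
continuous logarithm of the secant direction. It changes by a constant `c` with `exp c = -1` when
`h` grows by `2π`, and it is invariant under reversal of secants, so that the tangent turns by
`2 Im c`. At a lowest point of the curve all secants point into a half plane, which leaves only
`Im c = ±π`. -/
theorem exists_tangentAngle {z : ℝ → ℂ} (hz : ContDiff ℝ 1 z)
    (hper : Function.Periodic z (2 * Real.pi)) (hreg : ∀ a, deriv z a ≠ 0)
    (hinj : ∀ a h, Real.sin (h / 2) ≠ 0 → z (a + h) ≠ z a) :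
    ∃ θ : ℝ → ℝ, Continuous θ ∧ (∀ a, deriv z a = ‖deriv z a‖ * exp (θ a * I)) ∧
      ((∀ a, θ (a + 2 * Real.pi) = θ a + 2 * Real.pi) ∨
        ∀ a, θ (a + 2 * Real.pi) = θ a - 2 * Real.pi) := by
  have hpi := Real.pi_pos
  obtain ⟨L, hL, hexp⟩ := exists_continuous_log (continuous_secant hz hper)
    (secant_ne_zero hreg hinj)
  have hne := secant_ne_zero hreg hinj
  -- The ambiguity of the logarithm turns the symmetries of `secant z` into constants.
  have hshift : ∀ p : ℝ × ℝ,
      L (p.1, p.2 + 2 * Real.pi) - L p = L (0, 0 + 2 * Real.pi) - L (0, 0) := by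
    have hval : ∀ p : ℝ × ℝ, exp (L (p.1, p.2 + 2 * Real.pi) - L p) = -1 := by
      intro p
      rw [exp_sub, hexp, hexp, secant_add_period hper, neg_div, div_self (hne _)]
    intro p
    exact eq_of_exp_eq (g := fun p : ℝ × ℝ => L (p.1, p.2 + 2 * Real.pi) - L p)
      (by fun_prop) (fun a b => by rw [hval, hval]) p (0, 0)
  have hswap : ∀ p : ℝ × ℝ, L (p.1 + p.2, -p.2) = L p := by
    have hval : ∀ p : ℝ × ℝ, exp (L (p.1 + p.2, -p.2) - L p) = 1 := by
      intro p
      rw [exp_sub, hexp, hexp, secant_swap hper, div_self (hne _)]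
    intro p
    have := eq_of_exp_eq (g := fun p : ℝ × ℝ => L (p.1 + p.2, -p.2) - L p)
      (by fun_prop) (fun a b => by rw [hval, hval]) p (0, 0)
    simpa [sub_eq_zero] using this
  have hc : exp (L (0, 0 + 2 * Real.pi) - L (0, 0)) = -1 := by
    rw [exp_sub, hexp, hexp, secant_add_period hper, neg_div, div_self (hne _)]
  generalize L (0, 0 + 2 * Real.pi) - L (0, 0) = c at hshift hc
  -- Three moves lead from `(a, 0)` to `(a + 2π, 0)`: to `(a, 2π)`, by reversal of the secant to
  -- `(a + 2π, -2π)`, and from there back to `h = 0`.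
  have hturn : ∀ a, L (a + 2 * Real.pi, 0) = L (a, 0) + 2 * c := by
    intro a
    have h1 := hswap (a, 2 * Real.pi)
    have h2 := hshift (a, 0)
    have h3 := hshift (a + 2 * Real.pi, -(2 * Real.pi))
    simp only [zero_add, neg_add_cancel] at h1 h2 h3
    linear_combination h3 + h1 + h2
  obtain ⟨p, hp⟩ : ∃ p : ℤ, c = (2 * p + 1) * Real.pi * I := by
    rw [← exp_pi_mul_I, exp_eq_exp_iff_exists_int] at hc
    obtain ⟨p, hp⟩ := hc
    exact ⟨p, by rw [hp]; ring⟩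
  have hθ : ∀ a, deriv z a = ‖deriv z a‖ * exp ((L (a, 0)).im * I) := by
    intro a
    rw [← secant_zero, ← hexp, norm_exp, ofReal_exp, ← exp_add, re_add_im]
  have him : ∀ a, (L (a + 2 * Real.pi, 0)).im = (L (a, 0)).im + 2 * ((2 * p + 1) * Real.pi) := by
    intro a
    rw [hturn, hp]
    simp
  -- At a lowest point of the curve, all secants lie on one side of the tangent.
  obtain ⟨a, ha, hmin⟩ := exists_support hz hper
  have hψ : Continuous fun h => (L (a, h)).im - (L (a, 0)).im := by fun_prop
  have hψT : (L (a, 2 * Real.pi)).im - (L (a, 0)).im = (2 * p + 1) * Real.pi := by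
    have h2 := hshift (a, 0)
    simp only [zero_add] at h2
    rw [← sub_im, h2, hp]
    simp
  have hsin : ∀ h, Real.exp ((L (a, h)).re - (L (a, 0)).re) *
      Real.sin ((L (a, h)).im - (L (a, 0)).im) = (secant z (a, h)).im / (deriv z a).re := by
    intro h
    have h1 : deriv z a = ((deriv z a).re : ℂ) := by
      apply Complex.ext <;> simp [ha]
    have : exp (L (a, h) - L (a, 0)) = secant z (a, h) / ((deriv z a).re : ℂ) := by
      rw [exp_sub, hexp, hexp, secant_zero, ← h1]
    rw [← sub_re, ← sub_im, ← exp_im, this, div_ofReal_im]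
  have hup : ∀ h ∈ Icc 0 (2 * Real.pi), 0 ≤ (secant z (a, h)).im := by
    intro h hh
    unfold secant
    split_ifs with hs
    · rw [im_ofReal_mul, ha, mul_zero]
    · rw [div_ofReal_im]
      refine div_nonneg (by simpa using hmin (a + h)) (mul_nonneg zero_le_two ?_)
      exact Real.sin_nonneg_of_nonneg_of_le_pi (by linarith [hh.1]) (by linarith [hh.2])
  refine ⟨fun a => (L (a, 0)).im, by fun_prop, hθ, ?_⟩
  have hT : 0 ≤ 2 * Real.pi := by positivity
  rcases le_total 0 (deriv z a).re with hr | hr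
  · left
    have : p = 0 := eq_zero_of_sin_nonneg hT hψ (by simp) hψT (by
      intro t ht
      have h1 := hsin t
      have h2 := div_nonneg (hup t ht) hr
      rw [← h1] at h2
      exact nonneg_of_mul_nonneg_right h2 (Real.exp_pos _))
    intro b
    simp only [him b, this]
    push_cast; ring
  · right
    have : -p - 1 = 0 := eq_zero_of_sin_nonneg hT hψ.neg (by simp)
      (by simp only [Pi.neg_apply, hψT]; push_cast; ring) (by
      intro t ht
      have h1 := hsin t
      have h2 := div_nonpos_of_nonneg_of_nonpos (hup t ht) hr
      rw [← h1] at h2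
      have h3 := nonpos_of_mul_nonpos_right h2 (Real.exp_pos _)
      simpa only [Pi.neg_apply, Real.sin_neg, neg_nonneg] using h3)
    have hp' : (p : ℝ) = -1 := by exact_mod_cast (by omega : p = -1)
    intro b
    simp only [him b, hp']
    ring

/-! ### Simple closed curves of positive curvature are convex -/

lemma strictMono_of_eventually_lt {θ : ℝ → ℝ} (hθ : Continuous θ)
    (h : ∀ a, ∀ᶠ b in 𝓝[>] a, θ a < θ b) : StrictMono θ := by
  intro a b hab
  obtain ⟨c, hc, hmax⟩ := isCompact_Icc.exists_isMaxOn (s := Icc a b) ⟨a, le_rfl, hab.le⟩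
    hθ.continuousOn
  -- A maximum on `[a, b]` cannot be attained before `b`.
  have key : ∀ x ∈ Ico a b, ∃ y ∈ Icc a b, θ x < θ y := by
    intro x hx
    obtain ⟨y, hy, hyx⟩ := ((h x).and (Ioo_mem_nhdsGT hx.2)).exists
    exact ⟨y, ⟨hx.1.trans hyx.1.le, hyx.2.le⟩, hy⟩
  have hcb : c = b := by
    by_contra hne
    obtain ⟨y, hy, hlt⟩ := key c ⟨hc.1, lt_of_le_of_ne hc.2 hne⟩
    exact absurd (hmax hy) (not_le.2 hlt)
  obtain ⟨y, hy, hlt⟩ := key a ⟨le_rfl, hab⟩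
  exact hlt.trans_le (hcb ▸ hmax hy)

/-- A simple closed curve of positive curvature is strictly convex: apart from the point of
contact it lies strictly to the left of each of its tangents. Positive curvature makes the tangent
angle strictly increasing, and by the Umlaufsatz it increases by exactly `2π` in one period. -/
theorem tangent_cross_secant_pos {z : ℝ → ℂ} (hz : ContDiff ℝ 2 z)
    (hper : Function.Periodic z (2 * Real.pi))
    (hinj : ∀ a h, Real.sin (h / 2) ≠ 0 → z (a + h) ≠ z a)
    (hcurv : ∀ a, 0 < (starRingEnd ℂ (deriv z a) * deriv (deriv z) a).im) (a : ℝ) {b : ℝ}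
    (hb : b ∈ Ioo a (a + 2 * Real.pi)) :
    0 < (starRingEnd ℂ (deriv z a) * (z b - z a)).im := by
  have hpi := Real.pi_pos
  have hz1 : ContDiff ℝ 1 z := hz.of_le (by norm_num)
  have hreg : ∀ a, deriv z a ≠ 0 := by
    intro a h
    have := hcurv a
    simp [h] at this
  obtain ⟨θ, hθ, hpolar, hturn⟩ := exists_tangentAngle hz1 hper hreg hinj
  have hcross : ∀ a b, (starRingEnd ℂ (deriv z a) * deriv z b).im =
      ‖deriv z a‖ * ‖deriv z b‖ * Real.sin (θ b - θ a) := by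
    intro a b
    rw [hpolar a, hpolar b]
    simp only [map_mul, conj_ofReal, ← exp_conj, conj_I]
    rw [show (‖deriv z a‖ : ℂ) * exp (θ a * -I) * (‖deriv z b‖ * exp (θ b * I)) =
      ((‖deriv z a‖ * ‖deriv z b‖ : ℝ) : ℂ) * exp ((θ b - θ a : ℝ) * I) by
        push_cast; rw [sub_mul, sub_eq_neg_add, exp_add, mul_neg]; ring]
    rw [im_ofReal_mul, exp_ofReal_mul_I_im]
    simp
  have hd : Differentiable ℝ (deriv z) :=
    ((contDiff_succ_iff_deriv (n := 1)).1 hz).2.2.differentiable (by norm_num)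
  have hderiv : ∀ (w : ℂ) {g : ℝ → ℂ} {g' : ℂ} {x : ℝ}, HasDerivAt g g' x →
      HasDerivAt (fun x => (w * g x).im) (w * g').im x := by
    intro w g g' x hg
    exact imCLM.hasFDerivAt.comp_hasDerivAt x (hg.const_mul w)
  have hmono : StrictMono θ := by
    refine strictMono_of_eventually_lt hθ fun a => ?_
    -- The derivative of `b ↦ det (z' a, z' b)` at `a` is `det (z' a, z'' a) > 0`.
    have h1 := hderiv (starRingEnd ℂ (deriv z a)) (hd a).hasDerivAt
    have h2 : ∀ᶠ b in 𝓝[>] a, 0 < (starRingEnd ℂ (deriv z a) * deriv z b).im := by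
      have h3 := (hasDerivAt_iff_tendsto_slope.1 h1).eventually_const_lt (hcurv a)
      have h4 := h3.filter_mono (nhdsWithin_mono a (fun x (hx : a < x) => hx.ne'))
      filter_upwards [h4, self_mem_nhdsWithin] with b hb hab
      rw [slope_def_field, hcross a a, sub_self, Real.sin_zero, mul_zero, sub_zero] at hb
      exact (div_pos_iff_of_pos_right (sub_pos.2 hab)).1 hb
    have h5 : ∀ᶠ b in 𝓝[>] a, -Real.pi < θ b - θ a := by
      have : ContinuousAt (fun b => θ b - θ a) a := by fun_prop
      exact (this.eventually (lt_mem_nhds (by simpa using hpi))).filter_mono nhdsWithin_le_nhds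
    filter_upwards [h2, h5] with b hb hb'
    rw [hcross] at hb
    by_contra hle
    have hs := Real.sin_nonpos_of_nonpos_of_neg_pi_le (by linarith : θ b - θ a ≤ 0) hb'.le
    have := mul_nonpos_of_nonneg_of_nonpos
      (mul_nonneg (norm_nonneg (deriv z a)) (norm_nonneg (deriv z b))) hs
    linarith
  have hturn' : θ (a + 2 * Real.pi) = θ a + 2 * Real.pi := by
    rcases hturn with h | h
    · exact h a
    · have := hmono (show a < a + 2 * Real.pi by linarith)
      rw [h a] at this
      linarith
  -- The height over the tangent at `a` increases until the tangent has turned by `π`,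
  -- then decreases, and it vanishes at both ends.
  set H : ℝ → ℝ := fun b => (starRingEnd ℂ (deriv z a) * (z b - z a)).im with hH
  have hHd : ∀ b, HasDerivAt H (‖deriv z a‖ * ‖deriv z b‖ * Real.sin (θ b - θ a)) b := by
    intro b
    rw [← hcross]
    exact hderiv _ ((hz1.differentiable (by norm_num) b).hasDerivAt.sub_const _)
  have hHc : Continuous H := continuous_iff_continuousAt.2 fun b => (hHd b).continuousAt
  have hpos : ∀ b, 0 < ‖deriv z a‖ * ‖deriv z b‖ := fun b =>
    mul_pos (norm_pos_iff.2 (hreg a)) (norm_pos_iff.2 (hreg b))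
  have hHa : H a = 0 := by simp [hH]
  have hHe : H (a + 2 * Real.pi) = 0 := by simp [hH, hper a]
  obtain ⟨c, hc, hcθ⟩ := intermediate_value_Icc (by linarith : a ≤ a + 2 * Real.pi)
    hθ.continuousOn (show θ a + Real.pi ∈ Icc (θ a) (θ (a + 2 * Real.pi)) by
      rw [hturn']; constructor <;> linarith)
  change 0 < H b
  rcases le_total b c with hbc | hbc
  · rw [← hHa]
    refine strictMonoOn_of_deriv_pos (convex_Icc a c) hHc.continuousOn ?_
      ⟨le_rfl, hc.1⟩ ⟨hb.1.le, hbc⟩ hb.1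
    intro x hx
    rw [interior_Icc] at hx
    rw [(hHd x).deriv]
    have h1 := hmono hx.1
    have h2 := hmono hx.2
    exact mul_pos (hpos x) (Real.sin_pos_of_pos_of_lt_pi (by linarith) (by linarith))
  · rw [← hHe]
    refine strictAntiOn_of_deriv_neg (convex_Icc c (a + 2 * Real.pi)) hHc.continuousOn ?_
      ⟨hbc, hb.2.le⟩ ⟨hc.2, le_rfl⟩ hb.2
    intro x hx
    rw [interior_Icc] at hx
    rw [(hHd x).deriv]
    have h1 := hmono hx.1
    have h2 := hmono hx.2
    refine mul_neg_of_pos_of_neg (hpos x) ?_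
    rw [← Real.sin_sub_two_pi]
    exact Real.sin_neg_of_neg_of_neg_pi_lt (by linarith) (by linarith)

end

/-! ### The determinant of plane vectors -/

/-- The determinant `det (a, b)` of two plane vectors. -/
noncomputable def cross (a b : Plane) : ℝ := a 0 * b 1 - a 1 * b 0

lemma inner_J (a b : Plane) : inner ℝ a (J b) = cross b a := by
  simp [J, cross, PiLp.inner_apply, Fin.sum_univ_two]
  ring

lemma cross_sub_left (a b c : Plane) : cross (a - b) c = cross a c - cross b c := by
  simp [cross]; ring

lemma abs_cross_le (a b : Plane) : |cross a b| ≤ ‖a‖ * ‖b‖ := by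
  rw [← inner_J, mul_comm]
  have hJ : ‖J a‖ = ‖a‖ := by
    simp [J, EuclideanSpace.norm_eq, Fin.sum_univ_two, add_comm]
  rw [← hJ]
  exact abs_real_inner_le_norm b (J a)

lemma exists_smul_of_cross_eq_zero {v w : Plane} (hv : v ≠ 0) (h : cross v w = 0) :
    ∃ μ : ℝ, w = μ • v := by
  simp only [cross] at h
  by_cases h0 : v 0 = 0
  · have h1 : v 1 ≠ 0 := by
      intro h1
      exact hv (by ext i; fin_cases i <;> simp [h0, h1])
    refine ⟨w 1 / v 1, ?_⟩
    have hw : w 0 = 0 := by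
      rw [h0] at h
      simpa [h1] using h
    ext i
    fin_cases i
    · simp [h0, hw]
    · simp [h1]
  · refine ⟨w 0 / v 0, ?_⟩
    ext i
    fin_cases i
    · simp [h0]
    · simp
      field_simp
      linarith

lemma hasDerivAt_coord {v : ℝ → Plane} {v' : Plane} {x : ℝ} (hv : HasDerivAt v v' x) (i : Fin 2) :
    HasDerivAt (fun t => v t i) (v' i) x :=
  (EuclideanSpace.proj i : Plane →L[ℝ] ℝ).hasFDerivAt.comp_hasDerivAt x hv

lemma hasDerivAt_cross {v w : ℝ → Plane} {v' w' : Plane} {x : ℝ} (hv : HasDerivAt v v' x)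
    (hw : HasDerivAt w w' x) :
    HasDerivAt (fun t => cross (v t) (w t)) (cross v' (w x) + cross (v x) w') x := by
  refine (((hasDerivAt_coord hv 0).mul (hasDerivAt_coord hw 1)).sub
    ((hasDerivAt_coord hv 1).mul (hasDerivAt_coord hw 0))).congr_deriv ?_
  simp only [Poncelet.cross]
  ring

lemma contDiff_coord {n : WithTop ℕ∞} {v : ℝ → Plane} (hv : ContDiff ℝ n v) (i : Fin 2) :
    ContDiff ℝ n (fun t => v t i) :=
  (EuclideanSpace.proj i : Plane →L[ℝ] ℝ).contDiff.comp hv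

lemma contDiff_cross {n : WithTop ℕ∞} {v w : ℝ → Plane} (hv : ContDiff ℝ n v)
    (hw : ContDiff ℝ n w) : ContDiff ℝ n (fun t => cross (v t) (w t)) :=
  ((contDiff_coord hv 0).mul (contDiff_coord hw 1)).sub
    ((contDiff_coord hv 1).mul (contDiff_coord hw 0))

/-! ### The envelope of a family of lines -/

/-- The envelope of the lines through `y x` with direction `v x`, parametrized by the point of
contact. It is meaningful where `det (v, v')` does not vanish. -/
noncomputable def lineEnvelope (y v : ℝ → Plane) (x : ℝ) : Plane :=
  y x - (cross (v x) (deriv y x) / cross (v x) (deriv v x)) • v x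

lemma contDiff_deriv {E : Type*} [NormedAddCommGroup E] [NormedSpace ℝ E] {y : ℝ → E} {m : ℕ}
    (hy : ContDiff ℝ (m + 1 : ℕ) y) : ContDiff ℝ m (deriv y) := by
  push_cast at hy
  exact (contDiff_succ_iff_deriv.1 hy).2.2

lemma contDiff_lineEnvelope {y v : ℝ → Plane} {m : ℕ} (hy : ContDiff ℝ (m + 1 : ℕ) y)
    (hv : ContDiff ℝ (m + 1 : ℕ) v) (hD : ∀ x, cross (v x) (deriv v x) ≠ 0) :
    ContDiff ℝ m (lineEnvelope y v) := by
  have hle : ((m : ℕ) : WithTop ℕ∞) ≤ ((m + 1 : ℕ) : WithTop ℕ∞) := by exact_mod_cast m.le_succ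
  have hy0 := hy.of_le hle
  have hv0 := hv.of_le hle
  exact hy0.sub (((contDiff_cross hv0 (contDiff_deriv hy)).div
    (contDiff_cross hv0 (contDiff_deriv hv)) hD).smul hv0)

/-- The velocity of the envelope is parallel to the line. -/
lemma cross_deriv_lineEnvelope {y v : ℝ → Plane} (hy : ContDiff ℝ 2 y)
    (hv : ContDiff ℝ 2 v) (hD : ∀ x, cross (v x) (deriv v x) ≠ 0) (x : ℝ) :
    cross (v x) (deriv (lineEnvelope y v) x) = 0 := by
  have hq : DifferentiableAt ℝ (fun x => cross (v x) (deriv y x) / cross (v x) (deriv v x)) x := by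
    have hv1 : ContDiff ℝ 1 v := hv.of_le (by norm_num)
    exact ((contDiff_cross hv1 (contDiff_deriv (m := 1) hy)).div
      (contDiff_cross hv1 (contDiff_deriv (m := 1) hv)) hD).differentiable (by norm_num) x
  -- With `X = y - q v` this is `det (v, X') = det (v, y') - q det (v, v')`, in which `q'` drops out.
  have h := ((hy.differentiable (by norm_num) x).hasDerivAt.sub
    (hq.hasDerivAt.smul (hv.differentiable (by norm_num) x).hasDerivAt)).deriv
  have h' : deriv (lineEnvelope y v) x = _ := h
  rw [h']
  set q' := deriv (fun x => cross (v x) (deriv y x) / cross (v x) (deriv v x)) x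
  have e : cross (v x) (deriv y x - (((cross (v x) (deriv y x) / cross (v x) (deriv v x))
      • deriv v x) + q' • v x)) = cross (v x) (deriv y x) -
      cross (v x) (deriv y x) / cross (v x) (deriv v x) * cross (v x) (deriv v x) := by
    simp only [cross, PiLp.sub_apply, PiLp.add_apply, PiLp.smul_apply, smul_eq_mul]
    ring
  rw [e, div_mul_cancel₀ _ (hD x), sub_self]

lemma exists_deriv_lineEnvelope_eq_smul {y v : ℝ → Plane} (hy : ContDiff ℝ 2 y)
    (hv : ContDiff ℝ 2 v) (hD : ∀ x, cross (v x) (deriv v x) ≠ 0) (x : ℝ) :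
    ∃ μ : ℝ, deriv (lineEnvelope y v) x = μ • v x := by
  refine exists_smul_of_cross_eq_zero ?_ (cross_deriv_lineEnvelope hy hv hD x)
  intro h
  exact hD x (by simp [h, cross])

/-- The curvature numerator of the envelope `X` with `X' = μ v` is `μ² det (v, v')`, so it
vanishes exactly where the velocity does. Differentiating `det (v, X') = 0` gives
`det (v, X'') = μ det (v, v')` and avoids the derivative of `μ`. -/
lemma cross_deriv_deriv_lineEnvelope {y v : ℝ → Plane} (hy : ContDiff ℝ 3 y)
    (hv : ContDiff ℝ 3 v) (hD : ∀ x, cross (v x) (deriv v x) ≠ 0) {x μ : ℝ}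
    (hμ : deriv (lineEnvelope y v) x = μ • v x) :
    cross (deriv (lineEnvelope y v) x) (deriv (deriv (lineEnvelope y v)) x) =
      μ ^ 2 * cross (v x) (deriv v x) := by
  have hX : ContDiff ℝ 2 (lineEnvelope y v) := contDiff_lineEnvelope (m := 2) hy hv hD
  have hX' : HasDerivAt (deriv (lineEnvelope y v)) _ x :=
    ((contDiff_deriv (m := 1) hX).differentiable (by norm_num) x).hasDerivAt
  have h := hasDerivAt_cross (hv.differentiable (by norm_num) x).hasDerivAt hX'
  have hzero : (fun t => cross (v t) (deriv (lineEnvelope y v) t)) = fun _ => 0 :=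
    funext (cross_deriv_lineEnvelope (hy.of_le (by norm_num)) (hv.of_le (by norm_num)) hD)
  rw [hzero] at h
  have h0 := h.unique (hasDerivAt_const x (0 : ℝ))
  rw [hμ] at h0 ⊢
  simp only [cross, PiLp.smul_apply, smul_eq_mul] at h0 ⊢
  linear_combination μ * h0

/-! ### Periodic lifts of closed curves -/

lemma cderiv_coe (Y : S1 → Plane) (x : ℝ) :
    cderiv Y (x : S1) = deriv (fun t : ℝ => Y (t : S1)) x := by
  have h := deriv_comp_const_add (fun t : ℝ => Y (t : S1)) x 0
  rw [add_zero] at h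
  rw [← h]
  rfl

lemma cderiv_cderiv_coe (Y : S1 → Plane) (x : ℝ) :
    cderiv (cderiv Y) (x : S1) = deriv (deriv fun t : ℝ => Y (t : S1)) x := by
  rw [cderiv_coe]
  congr 1
  exact funext (cderiv_coe Y)

lemma curvatureNum_coe (Y : S1 → Plane) (x : ℝ) :
    curvatureNum Y (x : S1) = cross (deriv (fun t : ℝ => Y (t : S1)) x)
      (deriv (deriv fun t : ℝ => Y (t : S1)) x) := by
  rw [curvatureNum, inner_J, cderiv_coe, cderiv_cderiv_coe]

lemma forall_circle {p : S1 → Prop} : (∀ φ, p φ) ↔ ∀ x : ℝ, p (x : S1) :=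
  QuotientAddGroup.mk_surjective.forall

lemma continuous_of_continuous_comp_coe {α : Type*} [TopologicalSpace α] {g : S1 → α}
    (h : Continuous fun x : ℝ => g (x : S1)) : Continuous g :=
  isQuotientMap_quotient_mk'.continuous_iff.2 h

/-! ### Torsion maps of the circle -/

/-- An orientation preserving homeomorphism of the circle of finite order that has a fixed point is
the identity: a lift that fixes a point over the fixed point has an iterate equal to the identity,
and an increasing map of the line with this property is the identity. -/
lemma eq_id_of_fixedPoint {g : S1 → S1} {G : ℝ → ℝ} (hG : StrictMono G) (hc : Continuous G)
    (hlift : ∀ x : ℝ, (G x : S1) = g x) {n : ℕ} (hn : 0 < n) (hgn : g^[n] = id) {φ : S1}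
    (hφ : g φ = φ) : g = id := by
  obtain ⟨p, rfl⟩ := QuotientAddGroup.mk_surjective φ
  obtain ⟨m, hm⟩ : ∃ m : ℤ, m • (2 * Real.pi) = G p - p := by
    rw [← AddCircle.coe_eq_zero_iff, AddCircle.coe_sub, hlift]
    exact sub_eq_zero.2 hφ
  set H : ℝ → ℝ := fun x => G x - m • (2 * Real.pi) with hH
  have hHlift : Function.Semiconj ((↑) : ℝ → S1) H g := by
    intro x
    rw [hH, AddCircle.coe_sub, ← hlift, sub_eq_self, AddCircle.coe_eq_zero_iff]
    exact ⟨m, rfl⟩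
  have hHmono : StrictMono H := fun a b hab => sub_lt_sub_right (hG hab) _
  have hHc : Continuous H := by fun_prop
  have hHp : H p = p := by simp [hH, hm]
  have hiter : ∀ x, H^[n] x = x := by
    intro x
    have hval : ∀ x, ((H^[n] x - x : ℝ) : S1) = 0 := by
      intro x
      rw [AddCircle.coe_sub, (hHlift.iterate_right n) x, hgn, id, sub_self]
    have := (AddCircle.isCoveringMap_coe (2 * Real.pi)).const_of_comp
      (g := fun x => H^[n] x - x) ((hHc.iterate n).sub continuous_id)
      (fun a b => by rw [hval, hval]) x p
    simpa [Function.iterate_fixed hHp n, sub_eq_zero] using this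
  have hid : ∀ x, H x = x := by
    intro x
    have := ((Function.Commute.id_right (f := H)).iterate_pos_eq_iff_map_eq hHmono.monotone
      strictMono_id hn (x := x)).1 (by simpa using hiter x)
    simpa using this
  funext φ
  obtain ⟨x, rfl⟩ := QuotientAddGroup.mk_surjective φ
  have := hHlift x
  rw [hid] at this
  exact this.symm

lemma IsTorsionMap.iterate_ne_self {k n : ℕ} {f : S1 → S1} (hf : IsTorsionMap k n f) {i : ℕ}
    (hi : 0 < i) (hin : i < n) (φ : S1) : f^[i] φ ≠ φ := by
  intro h
  obtain ⟨-, F, hF, hF', hlift⟩ := hf.diffeo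
  have hmono : StrictMono F := strictMono_of_deriv_pos hF'
  have hsemi : Function.Semiconj ((↑) : ℝ → S1) F f := hlift
  refine hf.iterate_ne i hi hin (eq_id_of_fixedPoint (hmono.iterate i)
    (hF.continuous.iterate i) (hsemi.iterate_right i) (hi.trans hin) ?_ h)
  rw [← Function.iterate_mul, mul_comm, Function.iterate_mul, hf.iterate_eq, Function.iterate_id]

lemma IsTorsionMap.injOn_iterate {k n : ℕ} {f : S1 → S1} (hf : IsTorsionMap k n f) (φ : S1) :
    Set.InjOn (fun i => f^[i] φ) (Set.Iio n) := by
  have key : ∀ i j, i < j → j < n → f^[i] φ ≠ f^[j] φ := by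
    intro i j hij hj h
    refine hf.iterate_ne_self (Nat.sub_pos_of_lt hij) (lt_of_le_of_lt (Nat.sub_le j i) hj)
      (f^[i] φ) ?_
    rw [← Function.iterate_add_apply, Nat.sub_add_cancel hij.le, h]
  intro i hi j hj h
  rcases lt_trichotomy i j with hij | hij | hij
  · exact absurd h (key i j hij hj)
  · exact hij
  · exact absurd h.symm (key j i hij hi)

lemma IsOrientationPreservingDiffeo.continuous {k : ℕ} {f : S1 → S1}
    (hf : IsOrientationPreservingDiffeo k f) : Continuous f := by
  obtain ⟨-, F, hF, -, hlift⟩ := hf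
  refine continuous_of_continuous_comp_coe ?_
  simp only [← hlift]
  exact (AddCircle.continuous_mk' _).comp hF.continuous

/-! ### The envelope of the sides -/

lemma IsCk.continuous {k : ℕ} {Y : S1 → Plane} (hY : IsCk k Y) : Continuous Y :=
  continuous_of_continuous_comp_coe (ContDiff.continuous hY)

lemma envelopeDenom_coe (Y : S1 → Plane) {f : S1 → S1} {F : ℝ → ℝ}
    (hlift : ∀ x : ℝ, ((F x : ℝ) : S1) = f (x : S1)) (x : ℝ) :
    envelopeDenom Y f (x : S1) = cross (Y (F x) - Y x)
      (deriv (fun t : ℝ => Y (F t) - Y t) x) := by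
  rw [envelopeDenom, inner_J, cderiv_coe]
  simp only [hlift]

lemma envelope_coe (Y : S1 → Plane) {f : S1 → S1} {F : ℝ → ℝ}
    (hlift : ∀ x : ℝ, ((F x : ℝ) : S1) = f (x : S1)) (x : ℝ) :
    envelope Y f (x : S1) =
      lineEnvelope (fun t : ℝ => Y t) (fun t : ℝ => Y (F t) - Y t) x := by
  rw [envelope, envelopeDenom_coe Y hlift, inner_J, cderiv_coe, lineEnvelope, hlift]

/-- If the velocity of `X` is everywhere parallel to a continuous field `V`, then the lines with
direction `V` through the points of `X` are tangent to `X`, also at its singular points: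
`det (V τ, X' σ) = det (V τ - V σ, X' σ)`, and the first entry tends to `0`. -/
lemma isTangentAt_of_cderiv_eq_smul {X V : S1 → Plane} (hV : Continuous V)
    (h : ∀ σ, ∃ μ : ℝ, cderiv X σ = μ • V σ) {τ : S1} {a b : Plane} (hab : b - a = V τ)
    (hmem : X τ ∈ affineSpan ℝ {a, b}) : IsTangentAt X τ a b := by
  refine ⟨hmem, ?_⟩
  rw [Asymptotics.isLittleO_iff]
  intro c hc
  have hev : ∀ᶠ σ in 𝓝 τ, ‖V τ - V σ‖ < c := by
    have : ContinuousAt (fun σ => ‖V τ - V σ‖) τ := by fun_prop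
    exact this.eventually (gt_mem_nhds (by simpa using hc))
  filter_upwards [hev] with σ hσ
  obtain ⟨μ, hμ⟩ := h σ
  have e : inner ℝ (cderiv X σ) (J (b - a)) = cross (V τ - V σ) (cderiv X σ) := by
    rw [inner_J, hab, cross_sub_left, hμ]
    simp only [cross, PiLp.smul_apply, smul_eq_mul]
    ring
  rw [e, Real.norm_eq_abs]
  exact (abs_cross_le _ _).trans (by gcongr)

lemma envelope_mem_affineSpan (Y : S1 → Plane) (f : S1 → S1) (φ : S1) :
    envelope Y f φ ∈ affineSpan ℝ {Y φ, Y (f φ)} := by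
  have h := AffineMap.lineMap_mem_affineSpan_pair (contactParam Y f φ) (Y φ) (Y (f φ))
  convert h using 1
  rw [AffineMap.lineMap_apply, envelope, contactParam, neg_smul]
  simp [sub_eq_neg_add]

/-- The properties of a well-defined envelope of the chords from `Y φ` to `Y (f φ)`: its class, its
tangents, and the equivalence of non-vanishing curvature and regularity. -/
lemma envelope_spec {k : ℕ} (hk : 2 ≤ k) {Y : S1 → Plane} {f : S1 → S1} (hY : IsCk k Y)
    (hf : IsOrientationPreservingDiffeo k f) (hD : EnvelopeWellDefined Y f) :
    IsCk (k - 1) (envelope Y f) ∧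
    (∀ φ, IsTangentAt (envelope Y f) φ (Y φ) (Y (f φ))) ∧
    (3 ≤ k → (HasNonvanishingCurvature (envelope Y f) ↔
      IsRegular (envelope Y f))) := by
  obtain ⟨m, rfl⟩ : ∃ m, k = m + 1 := ⟨k - 1, by omega⟩
  obtain ⟨-, F, hF, -, hlift⟩ := id hf
  set y : ℝ → Plane := fun t => Y (t : S1) with hy
  set v : ℝ → Plane := fun t => Y (F t) - Y t with hv
  have hyC : ContDiff ℝ (m + 1 : ℕ) y := hY
  have hvC : ContDiff ℝ (m + 1 : ℕ) v := (hyC.comp hF).sub hyC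
  have hDv : ∀ x, cross (v x) (deriv v x) ≠ 0 := by
    intro x
    have := hD (x : S1)
    rwa [envelopeDenom_coe Y hlift] at this
  have hX : (fun x : ℝ => envelope Y f (x : S1)) = lineEnvelope y v :=
    funext (envelope_coe Y hlift)
  have h2 : (2 : WithTop ℕ∞) ≤ ((m + 1 : ℕ) : WithTop ℕ∞) := by exact_mod_cast hk
  have hsmul := exists_deriv_lineEnvelope_eq_smul (hyC.of_le h2) (hvC.of_le h2) hDv
  have hvne : ∀ x, v x ≠ 0 := fun x h => hDv x (by simp [h, cross])
  refine ⟨?_, ?_, ?_⟩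
  · rw [IsCk, hX]
    exact contDiff_lineEnvelope hyC hvC hDv
  · intro φ
    refine isTangentAt_of_cderiv_eq_smul (V := fun ψ => Y (f ψ) - Y ψ)
      ((hY.continuous.comp hf.continuous).sub hY.continuous) ?_ rfl
      (envelope_mem_affineSpan Y f φ)
    rw [forall_circle]
    intro x
    rw [cderiv_coe, hX, ← hlift]
    exact hsmul x
  · intro h3
    have h3' : (3 : WithTop ℕ∞) ≤ ((m + 1 : ℕ) : WithTop ℕ∞) := by exact_mod_cast h3
    rw [HasNonvanishingCurvature, Poncelet.IsRegular, forall_circle, forall_circle]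
    refine forall_congr' fun x => ?_
    obtain ⟨μ, hμ⟩ := hsmul x
    rw [curvatureNum_coe, cderiv_coe, hX,
      cross_deriv_deriv_lineEnvelope (hyC.of_le h3') (hvC.of_le h3') hDv hμ, hμ]
    simp [hDv x, hvne x]

/-! ### Simple closed vertex curves -/

/-- The curvature has constant sign, which is the sign of its integral. -/
lemma curvatureNum_pos {Y : S1 → Plane} (hY : IsCk 2 Y) (hor : IsPositivelyOriented Y)
    (hcurv : HasNonvanishingCurvature Y) (φ : S1) : 0 < curvatureNum Y φ := by
  have hc : Continuous fun x : ℝ => curvatureNum Y (x : S1) := by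
    simp only [curvatureNum_coe]
    have h1 : ContDiff ℝ (1 : ℕ) (deriv fun t : ℝ => Y (t : S1)) := contDiff_deriv (m := 1) hY
    exact (contDiff_cross (h1.of_le (by norm_num)) (contDiff_deriv (m := 0) h1)).continuous
  by_contra hneg
  have hall : ∀ x : ℝ, curvatureNum Y (x : S1) ≤ 0 := by
    intro x
    by_contra hx
    obtain ⟨y, rfl⟩ := QuotientAddGroup.mk_surjective φ
    obtain ⟨z, hz⟩ := mem_range_of_exists_le_of_exists_ge hc ⟨y, not_lt.1 hneg⟩
      ⟨x, (not_le.1 hx).le⟩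
    exact hcurv _ hz
  have : totalCurvature Y ≤ 0 := by
    rw [totalCurvature, ← neg_nonneg, ← intervalIntegral.integral_neg]
    refine intervalIntegral.integral_nonneg (by positivity) fun x _ => ?_
    exact neg_nonneg.2 (div_nonpos_of_nonpos_of_nonneg (hall x) (by positivity))
  exact absurd hor (not_lt.2 this)

/-- The identification of the plane with `ℂ` that takes `(a, b)` to `a + b i`. -/
noncomputable def toComplex : Plane →L[ℝ] ℂ :=
  (Complex.orthonormalBasisOneI.repr.symm : Plane ≃L[ℝ] ℂ)

lemma toComplex_apply (v : Plane) : toComplex v = ⟨v 0, v 1⟩ := by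
  have : toComplex v = Complex.orthonormalBasisOneI.repr.symm v := rfl
  rw [this, ← OrthonormalBasis.sum_repr_symm]
  apply Complex.ext <;> simp [Fin.sum_univ_two]

lemma conj_toComplex_mul_im (v w : Plane) :
    (starRingEnd ℂ (toComplex v) * toComplex w).im = cross v w := by
  simp [toComplex_apply, cross]
  ring

/-- Strict convexity of a simple closed curve of positive curvature, in terms of parameters on the
circle. -/
lemma cross_cderiv_chord_pos {Y : S1 → Plane} (hY : IsCk 2 Y) (hpos : ∀ φ, 0 < curvatureNum Y φ)
    (hinj : Function.Injective Y) {φ ψ : S1} (hne : ψ ≠ φ) :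
    0 < cross (cderiv Y φ) (Y ψ - Y φ) := by
  have hpi := Real.pi_pos
  set y : ℝ → Plane := fun t => Y (t : S1) with hy
  have hd : Differentiable ℝ y := ContDiff.differentiable hY (by norm_num)
  have hd' : Differentiable ℝ (deriv y) :=
    (contDiff_deriv (m := 1) hY).differentiable (by norm_num)
  have hz' : deriv (fun t => toComplex (y t)) = fun t => toComplex (deriv y t) := funext fun t =>
    (toComplex.hasFDerivAt.comp_hasDerivAt t (hd t).hasDerivAt).deriv
  have hz'' : deriv (fun t => toComplex (deriv y t)) = fun t => toComplex (deriv (deriv y) t) :=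
    funext fun t => (toComplex.hasFDerivAt.comp_hasDerivAt t (hd' t).hasDerivAt).deriv
  obtain ⟨a, rfl⟩ := QuotientAddGroup.mk_surjective φ
  obtain ⟨b, hb, rfl⟩ : ∃ b ∈ Set.Ico a (a + 2 * Real.pi), (b : S1) = ψ := by
    have : Fact (0 < 2 * Real.pi) := ⟨by positivity⟩
    have := AddCircle.coe_image_Ico_eq (2 * Real.pi) a
    exact (Set.ext_iff.1 this ψ).2 trivial
  have hab : a < b := lt_of_le_of_ne hb.1 fun h => hne (by rw [h])
  have key := tangent_cross_secant_pos (z := fun t => toComplex (y t))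
    (toComplex.contDiff.comp hY) (fun x => by simp only [hy, AddCircle.coe_add_period])
    (by
      intro a h hs heq
      have h1 : y (a + h) = y a :=
        (Complex.orthonormalBasisOneI.repr.symm).injective heq
      have h2 := hinj h1
      rw [AddCircle.coe_add, add_eq_left, AddCircle.coe_eq_zero_iff] at h2
      obtain ⟨m, hm⟩ := h2
      refine hs (Real.sin_eq_zero_iff.2 ⟨m, ?_⟩)
      rw [← hm, zsmul_eq_mul]
      ring)
    (by
      intro a
      rw [hz', hz'', conj_toComplex_mul_im, ← curvatureNum_coe]
      exact hpos _) a ⟨hab, hb.2⟩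
  rw [hz', ← map_sub, conj_toComplex_mul_im] at key
  have e : cderiv Y ((a : ℝ) : S1) = deriv y a := cderiv_coe Y a
  change 0 < cross (cderiv Y ((a : ℝ) : S1)) _
  rw [e]
  exact key

/-- On a simple vertex curve, `s = A / (A + f' B)`, where `A` and `B` are the determinants of the
velocities at `Y φ` and at `Y (f φ)` with the chord towards the other point; both are positive by
strict convexity. -/
lemma contactParam_mem_Ioo {Y : S1 → Plane} {f : S1 → S1} (hY : IsCk 2 Y)
    (hpos : ∀ φ, 0 < curvatureNum Y φ) (hinj : Function.Injective Y)
    (hf : IsOrientationPreservingDiffeo 1 f) {φ : S1} (hne : f φ ≠ φ) :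
    envelopeDenom Y f φ ≠ 0 ∧ 0 < contactParam Y f φ ∧ contactParam Y f φ < 1 := by
  obtain ⟨-, F, hF, hF', hlift⟩ := hf
  obtain ⟨x, rfl⟩ := QuotientAddGroup.mk_surjective φ
  change f (x : S1) ≠ (x : S1) at hne
  rw [← hlift] at hne
  have hA := cross_cderiv_chord_pos hY hpos hinj hne
  have hB := cross_cderiv_chord_pos hY hpos hinj hne.symm
  have hd : Differentiable ℝ fun t : ℝ => Y (t : S1) := ContDiff.differentiable hY (by norm_num)
  have hv : HasDerivAt (fun t : ℝ => Y (F t) - Y t)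
      (deriv F x • cderiv Y (F x) - cderiv Y (x : S1)) x := by
    rw [cderiv_coe, cderiv_coe]
    exact (HasDerivAt.scomp x (hd (F x)).hasDerivAt
      (hF.differentiable (by norm_num) x).hasDerivAt).sub (hd x).hasDerivAt
  have hD : envelopeDenom Y f (x : S1) = deriv F x * cross (cderiv Y (F x)) (Y x - Y (F x)) +
      cross (cderiv Y (x : S1)) (Y (F x) - Y x) := by
    rw [envelopeDenom_coe Y hlift, hv.deriv]
    simp only [cross, PiLp.smul_apply, PiLp.sub_apply, smul_eq_mul]
    ring
  have hs : contactParam Y f (x : S1) =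
      cross (cderiv Y (x : S1)) (Y (F x) - Y x) / envelopeDenom Y f (x : S1) := by
    rw [contactParam, inner_J, ← neg_div, ← hlift]
    congr 1
    simp only [cross]
    ring
  have hFB := mul_pos (hF' x) hB
  have hDpos : 0 < envelopeDenom Y f (x : S1) := by linarith
  rw [hs]
  refine ⟨hDpos.ne', div_pos hA hDpos, ?_⟩
  rw [div_lt_one hDpos]
  linarith

end Poncelet

theorem mainTheorem1 (k n : ℕ) (hk : 2 ≤ k) (hn : 2 ≤ n)
    (Y : Poncelet.S1 → Poncelet.Plane) (f : Poncelet.S1 → Poncelet.S1)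
    (hY : Poncelet.IsCk k Y) (hreg : Poncelet.IsRegular Y)
    (hor : Poncelet.IsPositivelyOriented Y) (hcurv : Poncelet.HasNonvanishingCurvature Y)
    (hf : Poncelet.IsTorsionMap k n f) :
    (Poncelet.EnvelopeWellDefined Y f →
      Poncelet.IsCk (k - 1) (Poncelet.envelope Y f) ∧
      Poncelet.IsPonceletPair n Y (Poncelet.envelope Y f) ∧
      (∀ φ, Poncelet.IsPonceletPolygon n Y (Poncelet.envelope Y f) (fun i => f^[i] φ)) ∧
      (∀ φ, Poncelet.IsTangentAt (Poncelet.envelope Y f) φ (Y φ) (Y (f φ))) ∧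
      (3 ≤ k → (Poncelet.HasNonvanishingCurvature (Poncelet.envelope Y f) ↔
        Poncelet.IsRegular (Poncelet.envelope Y f)))) ∧
    (Function.Injective Y →
      Poncelet.EnvelopeWellDefined Y f ∧
      ∀ φ, 0 < Poncelet.contactParam Y f φ ∧ Poncelet.contactParam Y f φ < 1 ∧
        Poncelet.envelope Y f φ ∈ openSegment ℝ (Y φ) (Y (f φ))) := by
  refine ⟨fun hD => ?_, fun hinj => ?_⟩
  · obtain ⟨hCk, htan, hcr⟩ := Poncelet.envelope_spec hk hY hf.diffeo hD
    have hpoly : ∀ φ, Poncelet.IsPonceletPolygon n Y (Poncelet.envelope Y f)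
        (fun i => f^[i] φ) := by
      intro φ
      refine ⟨by simp [hf.iterate_eq], hf.injOn_iterate φ, fun i _ h => ?_, fun i _ => ?_⟩
      · refine hD (f^[i] φ) ?_
        rw [Function.iterate_succ_apply'] at h
        rw [Poncelet.envelopeDenom, Poncelet.inner_J, h]
        simp [Poncelet.cross]
      · simp only [Function.iterate_succ_apply']
        exact ⟨_, htan _⟩
    exact ⟨hCk, ⟨hn, hY.continuous, ContDiff.of_le hCk (by exact_mod_cast (by omega : 1 ≤ k - 1)),
      fun q => ⟨fun i => f^[i] q, rfl, hpoly q⟩⟩, hpoly, htan, hcr⟩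
  · have hY2 : Poncelet.IsCk 2 Y := ContDiff.of_le hY (by exact_mod_cast hk)
    have hf1 : Poncelet.IsOrientationPreservingDiffeo 1 f := by
      obtain ⟨hb, F, hF, hF'⟩ := hf.diffeo
      exact ⟨hb, F, hF.of_le (by exact_mod_cast (by omega : 1 ≤ k)), hF'⟩
    have hcontact := fun φ => Poncelet.contactParam_mem_Ioo hY2
      (Poncelet.curvatureNum_pos hY2 hor hcurv) hinj hf1
      (hf.iterate_ne_self one_pos (by omega) φ)
    refine ⟨fun φ => (hcontact φ).1, fun φ => ⟨(hcontact φ).2.1, (hcontact φ).2.2, ?_⟩⟩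
    rw [openSegment_eq_image']
    refine ⟨_, (hcontact φ).2, ?_⟩
    simp only [Poncelet.contactParam, Poncelet.envelope, neg_smul, sub_eq_add_neg]
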